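/- Let $n\in\mathbb{N}$ and let $\theta_1,\dots,\theta_n$ be real numbers, $z_i=e^{-i\theta_i}$. On the Hilbert space $L^2(\mathbb{R})^n=L^2(\mathbb{R})\oplus\dots\oplus L^2(\mathbb{R})$ (complex-valued functions, Lebesgue measure) let $T$ be the unitary operator $T(f_1,\dots,f_n)=(z_1f_1(\cdot-1),\dots,z_nf_n(\cdot-1))$, so that $(T^kf)_i=e^{-ik\theta_i}f_i(\cdot-k)$ for $k\in\mathbb{Z}$. Let $\hat f(\xi)=\int_{\mathbb{R}}f(x)e^{-i\xi x}\,dx$ denote the Fourier transform (extended to $L^2(\mathbb{R})$ by continuity), applied componentwise. A subset $\Phi$ of a subspace $V\subset L^2(\mathbb{R})^n$ with $T^kV\subset V$ for all $k\in\mathbb{Z}$ is called a normalized tight frame (NTF) generator for $V$ if the family $(T^k\varphi)_{k\in\mathbb{Z},\,\varphi\in\Phi}$ is a normalized tight frame for $V$, i.e. $\sum_{\varphi\in\Phi}\sum_{k\in\mathbb{Z}}|\langle f,T^k\varphi\rangle|^2=\|f\|^2$ for all $f\in V$. Let $\Phi$ be a countable subset of $L^2(\mathbb{R})^n$. The following are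 equivalent: (i) $\Phi$ is an NTF generator for $L^2(\mathbb{R})^n$; (ii) for all $i,j\in\{1,\dots,n\}$ and all $k\in\mathbb{Z}$, for almost every $\xi\in\mathbb{R}$, the following series converges absolutely and $$\sum_{\varphi\in\Phi}\hat\varphi_i(\xi-\theta_i)\,\overline{\hat\varphi_j(\xi-\theta_j+2k\pi)}=\delta_{ij}\,\delta_{k,0}.$$ -/

import Mathlib

open MeasureTheory
open scoped FourierTransform ComplexConjugate

noncomputable section

namespace SuperWavelet

/-- The Hilbert space `L²(ℝ)`, Lebesgue measure, complex valued. -/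
abbrev L2R : Type := Lp ℂ 2 (volume : Measure ℝ)

/-- The Hilbert space `L²(ℝ)ⁿ = L²(ℝ) ⊕ ⋯ ⊕ L²(ℝ)` (orthogonal direct sum of `n` copies). -/
abbrev L2Rn (n : ℕ) : Type := PiLp 2 (fun _ : Fin n => L2R)

/-- The translation `f ↦ f(· - a)` on `L²(ℝ)`. -/
def translateL2 (a : ℝ) (f : L2R) : L2R :=
  Lp.compMeasurePreserving (fun x : ℝ => x - a) (measurePreserving_sub_right volume a) f

/-- The `k`-th power `T^k` of the shift `T = (z₁ T₀, …, zₙ T₀)` on `L²(ℝ)ⁿ`, where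
`T₀ f = f(· - 1)` and `z_i = e^{-i θ_i}`; thus `(T^k f)_i = e^{-i k θ_i} f_i(· - k)`. -/
def shift {n : ℕ} (θ : Fin n → ℝ) (k : ℤ) (f : L2Rn n) : L2Rn n :=
  WithLp.toLp 2 fun i =>
    Complex.exp (-Complex.I * (k : ℂ) * (θ i : ℂ)) • translateL2 (k : ℝ) (f i)

/-- A family `(e_i)` is a normalized tight frame for the subspace `V` of a Hilbert space:
its members lie in `V` and `∑ |⟨f, e_i⟩|² = ‖f‖²` for all `f ∈ V`. -/
def IsNormalizedTightFrame {H : Type*} [NormedAddCommGroup H] [InnerProductSpace ℂ H]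
    {ι : Type*} (V : Submodule ℂ H) (e : ι → H) : Prop :=
  (∀ i, e i ∈ V) ∧ ∀ f ∈ V, HasSum (fun i => ‖inner ℂ (e i) f‖ ^ 2) (‖f‖ ^ 2)

/-- A subspace is shift invariant if `T^k V ⊆ V` for all `k ∈ ℤ`. -/
def IsShiftInvariant {n : ℕ} (θ : Fin n → ℝ) (V : Submodule ℂ (L2Rn n)) : Prop :=
  ∀ (k : ℤ), ∀ f ∈ V, shift θ k f ∈ V

/-- `Φ` is a normalized tight frame generator for the shift invariant subspace `V`: `Φ ⊆ V` and
the family `T^k φ`, indexed by `k ∈ ℤ` and `φ ∈ Φ`, is a normalized tight frame for `V`. -/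
structure IsNTFGenerator {n : ℕ} (θ : Fin n → ℝ) (V : Submodule ℂ (L2Rn n))
    (Φ : Set (L2Rn n)) : Prop where
  shiftInvariant : IsShiftInvariant θ V
  subset : Φ ⊆ (V : Set (L2Rn n))
  frame : IsNormalizedTightFrame V (fun p : ℤ × Φ => shift θ p.1 (p.2 : L2Rn n))

/-- The Fourier transform `f̂(ξ) = ∫ f(x) e^{-i ξ x} dx` on `L²(ℝ)` (extended by continuity), as an
almost everywhere determined function: Mathlib's `𝓕 f` at `w` is `∫ f(x) e^{-2 π i x w} dx`
(extended by continuity), evaluated here at `w = ξ / (2π)`. -/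
def fourierHat (f : L2R) (ξ : ℝ) : ℂ :=
  (𝓕 f : L2R) (ξ / (2 * Real.pi))

end SuperWavelet

end

/-!
After a Fourier transform, `T^k` multiplies the `i`-th component by `e^{-ik(ξ + θᵢ)}`. Cut the
frequency axis of the `i`-th component into unit cells starting at the points of `-θᵢ/2π + ℤ`
(frequencies in Mathlib's normalization) and transport each cell to `(0, 1]`: on every cell `T^k`
is now multiplication by the same function `e^{-2πikw}`. If the transform of `f` lives on a finite
set `S` of cells, with fiber `f(w) ∈ ℂ^S` at `w`, then `⟨f, T^k φ⟩` is a Fourier coefficient of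
`w ↦ ⟨f(w), φ(w)⟩`, and Parseval's identity in `k` turns the frame identity into the statement that
for almost every `w` the vectors `φ(w)` form a normalized tight frame of `ℂ^S`. In finite dimension
this says that the coordinate rows of the family are orthonormal, which is (ii) read cell by cell.
-/

noncomputable section

namespace SuperWavelet

open Filter Topology Set Real

section TightFrames

variable {𝕜 H ι : Type*}

theorem hasSum_norm_sq_iff_tsum_enorm_sq {E : ι → Type*} {F : Type*}
    [∀ i, SeminormedAddCommGroup (E i)] [SeminormedAddCommGroup F] {x : ∀ i, E i} {y : F} :
    HasSum (fun i => ‖x i‖ ^ 2) (‖y‖ ^ 2) ↔ ∑' i, ‖x i‖ₑ ^ 2 = ‖y‖ₑ ^ 2 := by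
  rw [← ENNReal.summable.hasSum_iff]
  simp only [enorm_eq_nnnorm, ← ENNReal.coe_pow, ENNReal.hasSum_coe, ← NNReal.hasSum_coe,
    NNReal.coe_pow, coe_nnnorm]

theorem enorm_sq_eq_sum_enorm_sq [Fintype ι] {G : ι → Type*} [∀ i, SeminormedAddCommGroup (G i)]
    (x : PiLp 2 G) : ‖x‖ₑ ^ 2 = ∑ i, ‖x i‖ₑ ^ 2 := by
  have pythagoras : HasSum (fun i => ‖x i‖ ^ 2) (‖x‖ ^ 2) :=
    (PiLp.norm_sq_eq_of_L2 G x).symm ▸ hasSum_fintype fun i => ‖x i‖ ^ 2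
  rw [← hasSum_norm_sq_iff_tsum_enorm_sq.1 pythagoras, tsum_fintype]

theorem enorm_sq_eq_lintegral {X E : Type*} [MeasurableSpace X] {μ : Measure X}
    [NormedAddCommGroup E] (f : Lp E 2 μ) : ‖f‖ₑ ^ 2 = ∫⁻ x, ‖f x‖ₑ ^ 2 ∂μ := by
  rw [Lp.enorm_def]
  simpa using eLpNorm_nnreal_pow_eq_lintegral (f := f) (μ := μ) (p := 2) two_ne_zero

theorem hasSum_norm_sq_of_dense [NormedField 𝕜] [SeminormedAddCommGroup H] [NormedSpace 𝕜 H]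
    {G : ι → Type*} [∀ i, SeminormedAddCommGroup (G i)] [∀ i, NormedSpace 𝕜 (G i)]
    (L : ∀ i, H →L[𝕜] G i) {D : Set H} (hD : Dense D)
    (h : ∀ f ∈ D, HasSum (fun i => ‖L i f‖ ^ 2) (‖f‖ ^ 2)) (f : H) :
    HasSum (fun i => ‖L i f‖ ^ 2) (‖f‖ ^ 2) := by
  let A (s : Finset ι) : H →ₗ[𝕜] PiLp 2 (fun i : s => G i) :=
    (WithLp.linearEquiv 2 𝕜 (∀ i : s, G i)).symm ∘ₗ LinearMap.pi fun i : s => (L i : H →ₗ[𝕜] G i)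
  have norm_sq_A (s : Finset ι) (f : H) : ‖A s f‖ ^ 2 = ∑ i ∈ s, ‖L i f‖ ^ 2 := by
    rw [PiLp.norm_sq_eq_of_L2]
    exact Finset.sum_coe_sort s fun i => ‖L i f‖ ^ 2
  have bessel (s : Finset ι) (f : H) : ‖A s f‖ ≤ ‖f‖ := by
    refine le_of_sq_le_sq ?_ (norm_nonneg f)
    rw [norm_sq_A]
    have closed : IsClosed {f : H | ∑ i ∈ s, ‖L i f‖ ^ 2 ≤ ‖f‖ ^ 2} :=
      isClosed_le (by fun_prop) (by fun_prop)
    exact closed.closure_subset_iff.2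
      (fun f hf => sum_le_hasSum s (fun i _ => by positivity) (h f hf)) (hD f)
  have equicontinuous : Equicontinuous fun s f => ‖A s f‖ :=
    (LipschitzWith.uniformEquicontinuous _ 1 fun s => .of_dist_le_mul fun f g => by
      rw [NNReal.coe_one, one_mul, dist_eq_norm, dist_eq_norm]
      exact (abs_norm_sub_norm_le _ _).trans (by rw [← map_sub]; exact bessel s _)).equicontinuous
  have tendsto_norm_A : Tendsto (fun s => ‖A s f‖) atTop (𝓝 ‖f‖) :=
    (equicontinuous.isClosed_setOfPred_tendsto continuous_norm).closure_subset_iff.2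
      (fun f hf => by
        have tendsto_sqrt := (h f hf).sqrt
        simp only [← norm_sq_A, sqrt_sq (norm_nonneg _)] at tendsto_sqrt
        exact tendsto_sqrt) (hD f)
  simpa only [HasSum, norm_sq_A, SummationFilter.unconditional_filter] using tendsto_norm_A.pow 2

theorem hasSum_inner_of_hasSum_norm_sq [RCLike 𝕜] [SeminormedAddCommGroup H]
    [InnerProductSpace 𝕜 H] {G : ι → Type*} [∀ i, SeminormedAddCommGroup (G i)]
    [∀ i, InnerProductSpace 𝕜 (G i)] (L : ∀ i, H →ₗ[𝕜] G i)
    (h : ∀ f, HasSum (fun i => ‖L i f‖ ^ 2) (‖f‖ ^ 2)) (f g : H) :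
    HasSum (fun i => inner 𝕜 (L i f) (L i g)) (inner 𝕜 f g) := by
  have norm_sq (f : H) : HasSum (fun i => (‖L i f‖ : 𝕜) ^ 2) ((‖f‖ : 𝕜) ^ 2) := by
    exact_mod_cast RCLike.hasSum_ofReal 𝕜 |>.2 (h f)
  have re_part := (norm_sq (f + g)).sub (norm_sq (f - g))
  have im_part := ((norm_sq (f - (RCLike.I : 𝕜) • g)).sub
    (norm_sq (f + (RCLike.I : 𝕜) • g))).mul_right RCLike.I
  simpa only [inner_eq_sum_norm_sq_div_four, map_add, map_sub, map_smul] using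
    (re_part.add im_part).div_const 4

variable [NormedAddCommGroup H] [InnerProductSpace ℂ H]

theorem isNormalizedTightFrame_top_iff {e : ι → H} :
    IsNormalizedTightFrame ⊤ e ↔
      ∀ f, HasSum (fun i => ‖inner ℂ (e i) f‖ ^ 2) (‖f‖ ^ 2) := by
  simp [IsNormalizedTightFrame]

theorem isNormalizedTightFrame_top_of_dense {e : ι → H} {D : Set H} (hD : Dense D)
    (h : ∀ f ∈ D, HasSum (fun i => ‖inner ℂ (e i) f‖ ^ 2) (‖f‖ ^ 2)) :
    IsNormalizedTightFrame ⊤ e :=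
  isNormalizedTightFrame_top_iff.2 <| hasSum_norm_sq_of_dense (fun i => innerSL ℂ (e i)) hD h

theorem isNormalizedTightFrame_top_iff_hasSum_inner {e : ι → H} :
    IsNormalizedTightFrame ⊤ e ↔
      ∀ f g, HasSum (fun i => inner ℂ f (e i) * inner ℂ (e i) g) (inner ℂ f g) := by
  rw [isNormalizedTightFrame_top_iff]
  refine ⟨fun h f g => ?_, fun h f => ?_⟩
  · simpa [mul_comm] using
      hasSum_inner_of_hasSum_norm_sq (fun i => (innerSL ℂ (e i) : H →ₗ[ℂ] ℂ)) h f g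
  · rw [← Complex.hasSum_ofReal]
    simpa [← Complex.conj_mul', inner_self_eq_norm_sq_to_K] using h f f

theorem ae_isNormalizedTightFrame_top [TopologicalSpace.SeparableSpace H] {X : Type*}
    [MeasurableSpace X] {μ : Measure X} {e : X → ι → H}
    (h : ∀ f, ∀ᵐ x ∂μ, HasSum (fun i => ‖inner ℂ (e x i) f‖ ^ 2) (‖f‖ ^ 2)) :
    ∀ᵐ x ∂μ, IsNormalizedTightFrame ⊤ (e x) := by
  obtain ⟨D, countable_D, dense_D⟩ := TopologicalSpace.exists_countable_dense H
  filter_upwards [(ae_ball_iff countable_D).2 fun f _ => h f] with x hx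
  exact isNormalizedTightFrame_top_of_dense dense_D hx

theorem isNormalizedTightFrame_euclideanSpace_iff {κ : Type*} [Fintype κ] [DecidableEq κ]
    {x : ι → EuclideanSpace ℂ κ} :
    IsNormalizedTightFrame ⊤ x ↔
      ∀ a b, HasSum (fun i => x i a * conj (x i b)) (if a = b then 1 else 0) := by
  rw [isNormalizedTightFrame_top_iff_hasSum_inner]
  refine ⟨fun h a b => ?_, fun h f g => ?_⟩
  · simpa [EuclideanSpace.inner_single_left, EuclideanSpace.inner_single_right,
      eq_comm (a := a)] using
      h (EuclideanSpace.single a 1) (EuclideanSpace.single b 1)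
  · have expansion := hasSum_sum fun a (_ : a ∈ Finset.univ) => hasSum_sum fun b
      (_ : b ∈ Finset.univ) => (h a b).mul_left (conj (f a) * g b)
    convert! expansion using 1
    · ext i
      simp only [PiLp.inner_apply, RCLike.inner_apply, Finset.sum_mul_sum]
      exact Finset.sum_congr rfl fun a _ => Finset.sum_congr rfl fun b _ => by ring
    · simp [PiLp.inner_apply, mul_comm]

end TightFrames

section UnitInterval

theorem measurePreserving_add_right_Ioc (t : ℝ) :
    MeasurePreserving (fun w => w + t) (volume.restrict (Ioc 0 1))
      (volume.restrict (Ioc t (t + 1))) := by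
  have preimage_eq : (fun w => w + t) ⁻¹' Ioc t (t + 1) = Ioc 0 1 := by
    simp [Set.preimage_add_const_Ioc]
  simpa only [preimage_eq] using
    (measurePreserving_add_right volume t).restrict_preimage (s := Ioc t (t + 1)) measurableSet_Ioc

theorem lintegral_eq_tsum_lintegral_Ioc (f : ℝ → ENNReal) (c : ℝ) :
    ∫⁻ x, f x = ∑' m : ℤ, ∫⁻ w in Ioc 0 1, f (w + (c + m)) := by
  rw [← setLIntegral_univ, ← iUnion_Ioc_add_intCast c,
    lintegral_iUnion (fun _ => measurableSet_Ioc) (pairwise_disjoint_Ioc_add_intCast c)]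
  exact tsum_congr fun m => ((measurePreserving_add_right_Ioc _).lintegral_comp_emb
    (measurableEmbedding_addRight _) f).symm

theorem ae_iff_forall_ae_Ioc {p : ℝ → Prop} (c : ℝ) :
    (∀ᵐ x, p x) ↔ ∀ m : ℤ, ∀ᵐ w ∂volume.restrict (Ioc 0 1), p (w + (c + m)) := by
  conv_lhs => rw [← Measure.restrict_univ (μ := volume), ← iUnion_Ioc_add_intCast c,
    ae_restrict_iUnion_iff]
  refine forall_congr' fun m => ?_
  rw [← (measurePreserving_add_right_Ioc (c + m)).map_eq]
  exact (measurableEmbedding_addRight (c + m : ℝ)).ae_map_iff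

theorem hasSum_norm_sq_integral_fourierChar_smul {b : ℝ → ℂ}
    (hb : MemLp b 2 (volume.restrict (Ioc 0 1))) :
    HasSum (fun k : ℤ => ‖∫ w in Ioc 0 1, 𝐞 (k * w) • b w‖ ^ 2) (∫ w in Ioc 0 1, ‖b w‖ ^ 2) := by
  have fourierCoeffOn_neg (k : ℤ) :
      fourierCoeffOn zero_lt_one b (-k) = ∫ w in Ioc 0 1, 𝐞 (k * w) • b w := by
    rw [fourierCoeffOn_eq_integral, intervalIntegral.integral_of_le zero_le_one]
    simp [Circle.smul_def, fourierChar_apply, mul_assoc, mul_comm, mul_left_comm]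
  have parseval := hasSum_sq_fourierCoeffOn zero_lt_one hb
  rw [← (Equiv.neg ℤ).hasSum_iff, intervalIntegral.integral_of_le zero_le_one] at parseval
  simpa [Function.comp_def, fourierCoeffOn_neg] using parseval

theorem tsum_enorm_sq_integral_fourierChar_smul {b : ℝ → ℂ}
    (hb : MemLp b 2 (volume.restrict (Ioc 0 1))) :
    ∑' k : ℤ, ‖∫ w in Ioc 0 1, 𝐞 (k * w) • b w‖ₑ ^ 2 = ∫⁻ w in Ioc 0 1, ‖b w‖ₑ ^ 2 := by
  have parseval := hasSum_norm_sq_integral_fourierChar_smul hb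
  simp only [← ofReal_norm, ← ENNReal.ofReal_pow (norm_nonneg _)]
  rw [← ENNReal.ofReal_tsum_of_nonneg (fun _ => by positivity) parseval.summable,
    parseval.tsum_eq, ofReal_integral_eq_lintegral_ofReal (hb.integrable_norm_pow (by simp))
      (.of_forall fun _ => by positivity)]

end UnitInterval

section Translation

theorem memLp_top_fourierChar (a : ℝ) : MemLp (fun w : ℝ => (𝐞 (a * w) : ℂ)) ⊤ :=
  memLp_top_of_bound (by fun_prop) 1 (.of_forall fun w => (Circle.norm_coe _).le)

/-- The modulation `f ↦ e^{2πia·} f` on `L²(ℝ)`, which the Fourier transform turns translations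
into; it is encoded as multiplication by an element of `L^∞(ℝ)`. -/
def modulation (a : ℝ) : L2R →L[ℂ] L2R :=
  (ContinuousLinearMap.lsmul ℂ ℂ).holderL volume ⊤ 2 2 (memLp_top_fourierChar a).toLp

theorem coeFn_modulation (a : ℝ) (f : L2R) :
    modulation a f =ᵐ[volume] fun w => 𝐞 (a * w) • f w := by
  filter_upwards [(ContinuousLinearMap.lsmul ℂ ℂ).coeFn_holder (r := 2)
    (memLp_top_fourierChar a).toLp f, (memLp_top_fourierChar a).coeFn_toLp]
    with w holder_eq toLp_eq
  exact holder_eq.trans (congrArg (· * f w) toLp_eq)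

theorem coeFn_translateL2 (a : ℝ) (f : L2R) : translateL2 a f =ᵐ[volume] fun x => f (x - a) :=
  Lp.coeFn_compMeasurePreserving f (measurePreserving_sub_right volume a)

theorem continuous_translateL2 (a : ℝ) : Continuous (translateL2 a) :=
  (Lp.isometry_compMeasurePreserving (measurePreserving_sub_right volume a)).continuous

theorem translateL2_toLp (a : ℝ) (g : SchwartzMap ℝ ℂ) :
    translateL2 a (g.toLp 2) = (SchwartzMap.compSubConstCLM ℂ a g).toLp 2 := by
  refine Lp.ext ?_
  filter_upwards [coeFn_translateL2 a (g.toLp 2), SchwartzMap.coeFn_toLp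
    (SchwartzMap.compSubConstCLM ℂ a g) 2, (measurePreserving_sub_right volume
      a).quasiMeasurePreserving.ae (SchwartzMap.coeFn_toLp g 2 volume)]
    with x translate_eq toLp_eq toLp_translate_eq
  rw [translate_eq, toLp_eq, toLp_translate_eq, SchwartzMap.compSubConstCLM_apply]

theorem fourier_compSubConstCLM (a : ℝ) (g : SchwartzMap ℝ ℂ) (w : ℝ) :
    𝓕 (SchwartzMap.compSubConstCLM ℂ a g) w = 𝐞 (-a * w) • 𝓕 g w := by
  rw [SchwartzMap.fourier_coe, SchwartzMap.fourier_coe, mul_comm]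
  exact congrFun (VectorFourier.fourierIntegral_comp_add_right 𝐞 volume (innerₗ ℝ) g (-a)) w

theorem fourier_translateL2 (a : ℝ) (f : L2R) : 𝓕 (translateL2 a f) = modulation (-a) (𝓕 f) := by
  have continuous_fourier := (Lp.fourierTransformₗᵢ ℝ ℂ).continuous
  refine congrFun ((SchwartzMap.denseRange_toLpCLM (p := 2) ENNReal.ofNat_ne_top).equalizer
    (continuous_fourier.comp (continuous_translateL2 a))
    ((modulation (-a)).continuous.comp continuous_fourier) (funext fun g => Lp.ext ?_)) f
  change (𝓕 (translateL2 a (g.toLp 2)) : L2R) =ᵐ[volume] modulation (-a) (𝓕 (g.toLp 2) : L2R)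
  rw [translateL2_toLp, SchwartzMap.toLp_fourier_eq, SchwartzMap.toLp_fourier_eq]
  filter_upwards [SchwartzMap.coeFn_toLp (𝓕 (SchwartzMap.compSubConstCLM ℂ a g)) 2 volume,
    SchwartzMap.coeFn_toLp (𝓕 g) 2 volume, coeFn_modulation (-a) ((𝓕 g).toLp 2)]
    with w fourier_translate_eq fourier_eq modulation_eq
  rw [fourier_translate_eq, modulation_eq, fourier_eq, fourier_compSubConstCLM]

end Translation

section Fibers

/-- The square-integrable functions on the unit cell `(0, 1]` of the frequency axis. -/
abbrev L2I : Type := Lp ℂ 2 (volume.restrict (Ioc (0 : ℝ) 1))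

theorem exists_Lp_ae_eq_single (c : ℝ) (m : ℤ) (u : L2I) :
    ∃ g : L2R, ∀ m' : ℤ, (fun w => g (w + (c + m'))) =ᵐ[volume.restrict (Ioc 0 1)]
      (Pi.single m u : ℤ → L2I) m' := by
  have cell : MeasurePreserving (fun x => x - (c + m))
      (volume.restrict (Ioc (c + m) (c + m + 1))) (volume.restrict (Ioc 0 1)) := by
    simpa [sub_eq_add_neg] using
      (measurePreserving_add_right_Ioc (c + m)).symm (MeasurableEquiv.addRight (c + m : ℝ))
  have memLp : MemLp ((Ioc (c + m) (c + m + 1)).indicator fun x => u (x - (c + m))) 2 volume :=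
    (memLp_indicator_iff_restrict measurableSet_Ioc).2
      ((Lp.memLp u).comp_measurePreserving cell)
  refine ⟨memLp.toLp, fun m' => ?_⟩
  filter_upwards [(ae_iff_forall_ae_Ioc c).1 memLp.coeFn_toLp m', Lp.coeFn_zero ℂ 2
    (volume.restrict (Ioc 0 1)), ae_restrict_mem measurableSet_Ioc] with w toLp_eq zero_eq hw
  rw [toLp_eq]
  rcases eq_or_ne m' m with rfl | hm
  · rw [indicator_of_mem (by constructor <;> linarith [hw.1, hw.2]), add_sub_cancel_right,
      Pi.single_eq_same]
  · rw [indicator_of_notMem, Pi.single_eq_of_ne hm, zero_eq, Pi.zero_apply]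
    rintro ⟨lower, upper⟩
    have lt_succ : (m' : ℝ) < m + 1 := by linarith [hw.1]
    have lt_succ' : (m : ℝ) < m' + 1 := by linarith [hw.2]
    norm_cast at lt_succ lt_succ'
    omega

variable {n : ℕ} (θ : Fin n → ℝ)

/-- The left endpoint of the cell `(m - θᵢ/2π, m + 1 - θᵢ/2π]` of the frequency axis of the `i`-th
component, indexed by `a = (i, m)`; the offset makes the phase `e^{-ikθᵢ}` of the shift cancel. -/
def cellStart (a : Fin n × ℤ) : ℝ := -(θ a.1 / (2 * π)) + a.2

/-- The fiber of `f` over the cell `a = (i, m)`: the restriction of the Fourier transform of the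
`i`-th component to that cell, transported to the unit cell. -/
def fiber (a : Fin n × ℤ) : L2Rn n →L[ℂ] L2I :=
  (Lp.compMeasurePreservingₗᵢ ℂ _
    (measurePreserving_add_right_Ioc (cellStart θ a))).toContinuousLinearMap ∘L
  LpToLpRestrictCLM ℝ ℂ ℂ volume 2 (Ioc (cellStart θ a) (cellStart θ a + 1)) ∘L
  (Lp.fourierTransformₗᵢ ℝ ℂ : L2R →L[ℂ] L2R) ∘L PiLp.proj 2 _ a.1

theorem coeFn_fiber (a : Fin n × ℤ) (f : L2Rn n) :
    fiber θ a f =ᵐ[volume.restrict (Ioc 0 1)] fun w => (𝓕 (f a.1) : L2R) (w + cellStart θ a) := by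
  have cell := measurePreserving_add_right_Ioc (cellStart θ a)
  exact (Lp.coeFn_compMeasurePreserving _ cell).trans
    (cell.quasiMeasurePreserving.ae_eq_comp (LpToLpRestrictCLM_coeFn ℂ _ _))

theorem fiber_shift (k : ℤ) (f : L2Rn n) (a : Fin n × ℤ) :
    fiber θ a (shift θ k f) =ᵐ[volume.restrict (Ioc 0 1)]
      fun w => 𝐞 (-(k * w)) • fiber θ a f w := by
  have phase (w : ℝ) : Complex.exp (-Complex.I * k * θ a.1) * 𝐞 (-k * (w + cellStart θ a)) =
      𝐞 (-(k * w)) := by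
    rw [fourierChar_apply, fourierChar_apply, ← Complex.exp_add, Complex.exp_eq_exp_iff_exists_int]
    refine ⟨-(k * a.2), ?_⟩
    have pi_ne_zero : (π : ℂ) ≠ 0 := mod_cast Real.pi_ne_zero
    simp only [cellStart]
    push_cast
    field_simp
    ring
  have fourier_shift : 𝓕 (shift θ k f a.1) =
      Complex.exp (-Complex.I * k * θ a.1) • modulation (-k) (𝓕 (f a.1)) := by
    rw [← fourier_translateL2]
    exact FourierTransform.fourier_smul _ _
  have fourier_shift_ae : ∀ᵐ w, (𝓕 (shift θ k f a.1) : L2R) w =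
      (Complex.exp (-Complex.I * k * θ a.1) * 𝐞 (-k * w)) * (𝓕 (f a.1) : L2R) w := by
    rw [fourier_shift]
    filter_upwards [Lp.coeFn_smul (Complex.exp (-Complex.I * k * θ a.1))
      (modulation (-k) (𝓕 (f a.1) : L2R)), coeFn_modulation (-k) (𝓕 (f a.1))]
      with w smul_eq modulation_eq
    rw [smul_eq, Pi.smul_apply, modulation_eq, Circle.smul_def, smul_eq_mul, smul_eq_mul]
    exact (mul_assoc _ _ _).symm
  filter_upwards [coeFn_fiber θ a f, coeFn_fiber θ a (shift θ k f),
    (ae_iff_forall_ae_Ioc _).1 fourier_shift_ae a.2] with w fiber_eq shift_eq hat_eq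
  rw [fiber_eq, shift_eq, Circle.smul_def, smul_eq_mul, ← phase]
  exact hat_eq

theorem hasSum_norm_fiber_sq (f : L2Rn n) :
    HasSum (fun a => ‖fiber θ a f‖ ^ 2) (‖f‖ ^ 2) := by
  have norm_component (i : Fin n) : ∑' m : ℤ, ‖fiber θ (i, m) f‖ₑ ^ 2 = ‖f i‖ₑ ^ 2 := by
    rw [← (Lp.fourierTransformₗᵢ ℝ ℂ).enorm_map, enorm_sq_eq_lintegral,
      lintegral_eq_tsum_lintegral_Ioc _ (-(θ i / (2 * π)))]
    refine tsum_congr fun m => (enorm_sq_eq_lintegral _).trans (lintegral_congr_ae ?_)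
    filter_upwards [coeFn_fiber θ (i, m) f] with w hw
    rw [hw]
    rfl
  rw [hasSum_norm_sq_iff_tsum_enorm_sq, ENNReal.summable.tsum_prod' fun _ => ENNReal.summable,
    enorm_sq_eq_sum_enorm_sq, tsum_fintype]
  exact Finset.sum_congr rfl fun i _ => norm_component i

theorem hasSum_inner_fiber (f g : L2Rn n) :
    HasSum (fun a => inner ℂ (fiber θ a f) (fiber θ a g)) (inner ℂ f g) :=
  hasSum_inner_of_hasSum_norm_sq (fun a => (fiber θ a : L2Rn n →ₗ[ℂ] L2I))
    (hasSum_norm_fiber_sq θ) f g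

theorem exists_fiber_eq_single (a : Fin n × ℤ) (u : L2I) :
    ∃ f, ∀ b, fiber θ b f = (Pi.single a u : Fin n × ℤ → L2I) b := by
  obtain ⟨g, hg⟩ := exists_Lp_ae_eq_single (-(θ a.1 / (2 * π))) a.2 u
  obtain ⟨h, rfl⟩ := (Lp.fourierTransformₗᵢ ℝ ℂ).surjective g
  refine ⟨PiLp.single 2 a.1 h, fun b => Lp.ext ((coeFn_fiber θ b _).trans ?_)⟩
  obtain ⟨i, m⟩ := a
  obtain ⟨j, m'⟩ := b
  rcases eq_or_ne j i with rfl | hij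
  · have single_same : (PiLp.single 2 j h : L2Rn n) j = h := by simp
    convert! hg m' using 3
    · rw [single_same]
      rfl
    · simp [Pi.single_apply]
  · have fourier_zero : (𝓕 ((PiLp.single 2 i h : L2Rn n) j) : L2R) = 0 := by
      simp [hij]
    rw [fourier_zero, Pi.single_eq_of_ne (by simp [hij])]
    filter_upwards [(ae_iff_forall_ae_Ioc _).1 (Lp.coeFn_zero ℂ 2 volume) m',
      Lp.coeFn_zero ℂ 2 (volume.restrict (Ioc 0 1))] with w hw hw'
    exact hw.trans hw'.symm

theorem exists_fiber_eq (S : Finset (Fin n × ℤ)) (u : S → L2I) :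
    ∃ f, (∀ a : S, fiber θ a f = u a) ∧ ∀ a ∉ S, fiber θ a f = 0 := by
  choose f hf using fun a : S => exists_fiber_eq_single θ a (u a)
  refine ⟨∑ a, f a, fun a => ?_, fun a ha => ?_⟩
  · simp only [map_sum, hf, Pi.single_apply, SetCoe.ext_iff, Finset.sum_ite_eq, Finset.mem_univ,
      if_true]
  · rw [map_sum]
    refine Finset.sum_eq_zero fun b _ => ?_
    rw [hf, Pi.single_eq_of_ne]
    exact fun h => ha (h ▸ b.2)

end Fibers

section BoundedFibers

variable {n : ℕ} (θ : Fin n → ℝ)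

/-- The vectors with finitely many nonzero fibers, all of them bounded: a dense subspace on which
the frame coefficients can be computed by Parseval's identity on the unit cell. -/
def boundedFibers : Submodule ℂ (L2Rn n) where
  carrier := {f | (∃ S : Finset (Fin n × ℤ), ∀ a ∉ S, fiber θ a f = 0) ∧
    ∀ a, MemLp (fiber θ a f) ⊤ (volume.restrict (Ioc 0 1))}
  zero_mem' := by
    refine ⟨⟨∅, by simp⟩, fun a => ?_⟩
    rw [map_zero]
    exact MemLp.zero'.ae_eq (Lp.coeFn_zero ℂ 2 _).symm
  add_mem' := by
    classical
    rintro f g ⟨⟨S, hS⟩, hf⟩ ⟨⟨T, hT⟩, hg⟩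
    refine ⟨⟨S ∪ T, fun a ha => ?_⟩, fun a => ?_⟩
    · rw [Finset.notMem_union] at ha
      rw [map_add, hS a ha.1, hT a ha.2, add_zero]
    · rw [map_add]
      exact ((hf a).add (hg a)).ae_eq (Lp.coeFn_add _ _).symm
  smul_mem' := by
    rintro c f ⟨⟨S, hS⟩, hf⟩
    refine ⟨⟨S, fun a ha => by rw [map_smul, hS a ha, smul_zero]⟩, fun a => ?_⟩
    rw [map_smul]
    exact ((hf a).const_smul c).ae_eq (Lp.coeFn_smul _ _).symm

theorem exists_mem_boundedFibers_eq_indicatorConstLp (S : Finset (Fin n × ℤ)) (z : S → ℂ)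
    {E : Set ℝ} (hE : MeasurableSet E) :
    ∃ f ∈ boundedFibers θ, (∀ a ∉ S, fiber θ a f = 0) ∧
      ∀ a : S, fiber θ a f = indicatorConstLp 2 hE (measure_ne_top _ E) (z a) := by
  obtain ⟨f, fiber_eq, fiber_eq_zero⟩ := exists_fiber_eq θ S fun a =>
    indicatorConstLp 2 hE (measure_ne_top (volume.restrict (Ioc 0 1)) E) (z a)
  refine ⟨f, ⟨⟨S, fiber_eq_zero⟩, fun a => ?_⟩, fiber_eq_zero, fiber_eq⟩
  by_cases ha : a ∈ S
  · rw [fiber_eq ⟨a, ha⟩]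
    exact (memLp_indicator_const ⊤ hE (z ⟨a, ha⟩) (.inr (measure_ne_top _ _))).ae_eq
      indicatorConstLp_coeFn.symm
  · rw [fiber_eq_zero a ha]
    exact MemLp.zero'.ae_eq (Lp.coeFn_zero ℂ 2 _).symm

theorem dense_boundedFibers : Dense (boundedFibers θ : Set (L2Rn n)) := by
  rw [Submodule.dense_iff_topologicalClosure_eq_top, Submodule.topologicalClosure_eq_top_iff,
    Submodule.eq_bot_iff]
  intro g hg
  have fiber_eq_zero (a : Fin n × ℤ) : fiber θ a g = 0 := by
    rw [Lp.eq_zero_iff_ae_eq_zero]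
    refine Lp.ae_eq_zero_of_forall_setIntegral_eq_zero _ two_ne_zero ENNReal.ofNat_ne_top
      (fun E _ _ => (Lp.memLp _).integrable one_le_two |>.integrableOn) fun E hE _ => ?_
    obtain ⟨f, hf, f_eq_zero, f_eq⟩ :=
      exists_mem_boundedFibers_eq_indicatorConstLp θ {a} (fun _ => 1) hE
    have inner_fiber := (hasSum_single a fun b hb => by
      rw [f_eq_zero b (by simpa using hb), inner_zero_left]).unique (hasSum_inner_fiber θ f g)
    rwa [f_eq ⟨a, Finset.mem_singleton_self a⟩, L2.inner_indicatorConstLp_one, hg f hf]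
      at inner_fiber
  have norm_sq_eq := hasSum_norm_fiber_sq θ g
  simp only [fiber_eq_zero, norm_zero, ne_eq, OfNat.ofNat_ne_zero, not_false_eq_true, zero_pow]
    at norm_sq_eq
  simpa using norm_sq_eq.unique hasSum_zero

/-- The vector of values at `w` of the fibers of `f` over the cells in `S`. -/
def fiberVec (S : Finset (Fin n × ℤ)) (f : L2Rn n) (w : ℝ) : EuclideanSpace ℂ S :=
  WithLp.toLp 2 fun a => fiber θ a f w

theorem measurable_fiberVec (S : Finset (Fin n × ℤ)) (f : L2Rn n) :
    Measurable (fiberVec θ S f) :=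
  (PiLp.continuous_toLp 2 _).measurable.comp <|
    measurable_pi_lambda _ fun a => (Lp.stronglyMeasurable (fiber θ a f)).measurable

variable {θ} {S : Finset (Fin n × ℤ)} {f : L2Rn n}

theorem inner_eq_integral_inner_fiberVec (hS : ∀ a ∉ S, fiber θ a f = 0) (g : L2Rn n) :
    inner ℂ g f = ∫ w in Ioc 0 1, inner ℂ (fiberVec θ S g w) (fiberVec θ S f w) := by
  have finite_sum : HasSum (fun a => inner ℂ (fiber θ a g) (fiber θ a f))
      (∑ a ∈ S, inner ℂ (fiber θ a g) (fiber θ a f)) :=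
    hasSum_sum_of_ne_finset_zero fun a ha => by rw [hS a ha, inner_zero_right]
  rw [(hasSum_inner_fiber θ g f).unique finite_sum]
  simp only [PiLp.inner_apply, fiberVec]
  rw [integral_finsetSum _ fun a _ => L2.integrable_inner _ _, ← Finset.sum_coe_sort]
  rfl

theorem enorm_sq_eq_lintegral_fiberVec (hS : ∀ a ∉ S, fiber θ a f = 0) :
    ‖f‖ₑ ^ 2 = ∫⁻ w in Ioc 0 1, ‖fiberVec θ S f w‖ₑ ^ 2 := by
  rw [← hasSum_norm_sq_iff_tsum_enorm_sq.1 (hasSum_norm_fiber_sq θ f),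
    tsum_eq_sum (s := S) fun a ha => by simp [hS a ha], ← Finset.sum_coe_sort]
  simp only [enorm_sq_eq_lintegral, enorm_sq_eq_sum_enorm_sq, fiberVec]
  exact (lintegral_finsetSum _ (by fun_prop)).symm

theorem tsum_enorm_sq_inner_shift (hf : f ∈ boundedFibers θ) (hS : ∀ a ∉ S, fiber θ a f = 0)
    (φ : L2Rn n) :
    ∑' k : ℤ, ‖inner ℂ (shift θ k φ) f‖ₑ ^ 2 =
      ∫⁻ w in Ioc 0 1, ‖(inner ℂ (fiberVec θ S φ w) (fiberVec θ S f w) : ℂ)‖ₑ ^ 2 := by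
  have memLp : MemLp (fun w => (inner ℂ (fiberVec θ S φ w) (fiberVec θ S f w) : ℂ)) 2
      (volume.restrict (Ioc 0 1)) := by
    simp only [PiLp.inner_apply]
    exact memLp_finsetSum _ fun a _ => (Lp.memLp (fiber θ a φ)).star.mul (hf.2 a)
  rw [← tsum_enorm_sq_integral_fourierChar_smul memLp]
  refine tsum_congr fun k => ?_
  rw [inner_eq_integral_inner_fiberVec hS]
  congr 2
  refine integral_congr_ae ?_
  filter_upwards [ae_all_iff.2 fun a : S => fiber_shift θ k φ a] with w hw
  have fiberVec_shift : fiberVec θ S (shift θ k φ) w = 𝐞 (-(k * w)) • fiberVec θ S φ w :=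
    PiLp.ext hw
  rw [fiberVec_shift, Circle.smul_def, inner_smul_left, AddChar.map_neg_eq_inv,
    Circle.coe_inv_eq_conj, Complex.conj_conj, Circle.smul_def, smul_eq_mul]

theorem tsum_enorm_sq_inner_shift_family {ι : Type*} [Countable ι] (hf : f ∈ boundedFibers θ)
    (hS : ∀ a ∉ S, fiber θ a f = 0) (φ : ι → L2Rn n) :
    ∑' p : ℤ × ι, ‖inner ℂ (shift θ p.1 (φ p.2)) f‖ₑ ^ 2 =
      ∫⁻ w in Ioc 0 1, ∑' i, ‖(inner ℂ (fiberVec θ S (φ i) w) (fiberVec θ S f w) : ℂ)‖ₑ ^ 2 := by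
  rw [ENNReal.summable.tsum_prod' fun _ => ENNReal.summable, ENNReal.tsum_comm,
    lintegral_tsum fun i => ?_]
  · exact tsum_congr fun i => tsum_enorm_sq_inner_shift hf hS (φ i)
  · have := measurable_fiberVec θ S
    fun_prop

end BoundedFibers

section FiberFrames

variable {ι : Type*} [Countable ι] {n : ℕ} {θ : Fin n → ℝ} {φ : ι → L2Rn n}

theorem isNormalizedTightFrame_shift_of_ae_fiberVec
    (h : ∀ S, ∀ᵐ w ∂volume.restrict (Ioc 0 1),
      IsNormalizedTightFrame ⊤ fun i => fiberVec θ S (φ i) w) :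
    IsNormalizedTightFrame ⊤ fun p : ℤ × ι => shift θ p.1 (φ p.2) := by
  refine isNormalizedTightFrame_top_of_dense (dense_boundedFibers θ) fun f hf => ?_
  obtain ⟨S, hS⟩ := hf.1
  rw [hasSum_norm_sq_iff_tsum_enorm_sq, tsum_enorm_sq_inner_shift_family hf hS,
    enorm_sq_eq_lintegral_fiberVec hS]
  refine lintegral_congr_ae ?_
  filter_upwards [h S] with w hw
  exact hasSum_norm_sq_iff_tsum_enorm_sq.1 (isNormalizedTightFrame_top_iff.1 hw _)

theorem ae_isNormalizedTightFrame_fiberVec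
    (h : IsNormalizedTightFrame ⊤ fun p : ℤ × ι => shift θ p.1 (φ p.2))
    (S : Finset (Fin n × ℤ)) :
    ∀ᵐ w ∂volume.restrict (Ioc 0 1), IsNormalizedTightFrame ⊤ fun i => fiberVec θ S (φ i) w := by
  refine ae_isNormalizedTightFrame_top fun z => ?_
  simp only [hasSum_norm_sq_iff_tsum_enorm_sq]
  have measurable_φ := fun i => measurable_fiberVec θ S (φ i)
  refine ae_eq_of_forall_setLIntegral_eq_of_sigmaFinite (by fun_prop) (by fun_prop)
    fun E hE _ => ?_
  -- The frame identity for the vector with fiber `z` on `E` and `0` off `E` is the equality of the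
  -- two integrals over `E`.
  obtain ⟨f, hf, hS, f_eq⟩ := exists_mem_boundedFibers_eq_indicatorConstLp θ S (fun a => z a) hE
  have fiberVec_f : fiberVec θ S f =ᵐ[volume.restrict (Ioc 0 1)] E.indicator fun _ => z := by
    filter_upwards [ae_all_iff.2 fun a : S => indicatorConstLp_coeFn (p := 2) (hs := hE)
      (hμs := measure_ne_top (volume.restrict (Ioc 0 1)) E) (c := z a)] with w hw
    refine PiLp.ext fun a => ?_
    rw [fiberVec, PiLp.toLp_apply, f_eq, hw]
    by_cases hwE : w ∈ E <;> simp [hwE]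
  have frame := hasSum_norm_sq_iff_tsum_enorm_sq.1 (isNormalizedTightFrame_top_iff.1 h f)
  rw [tsum_enorm_sq_inner_shift_family hf hS, enorm_sq_eq_lintegral_fiberVec hS] at frame
  rw [← lintegral_indicator hE, ← lintegral_indicator hE]
  refine (lintegral_congr_ae ?_).trans (frame.trans (lintegral_congr_ae ?_))
  all_goals
    filter_upwards [fiberVec_f] with w hw
    rw [hw]
    by_cases hwE : w ∈ E <;> simp [hwE]

theorem isNormalizedTightFrame_shift_iff_hasSum_fiber :
    IsNormalizedTightFrame ⊤ (fun p : ℤ × ι => shift θ p.1 (φ p.2)) ↔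
      ∀ a b, ∀ᵐ w ∂volume.restrict (Ioc 0 1),
        HasSum (fun i => fiber θ a (φ i) w * conj (fiber θ b (φ i) w))
          (if a = b then 1 else 0) := by
  refine ⟨fun h a b => ?_, fun h => isNormalizedTightFrame_shift_of_ae_fiberVec fun S => ?_⟩
  · filter_upwards [ae_isNormalizedTightFrame_fiberVec h {a, b}] with w hw
    simpa [fiberVec] using
      isNormalizedTightFrame_euclideanSpace_iff.1 hw ⟨a, by simp⟩ ⟨b, by simp⟩
  · filter_upwards [ae_all_iff.2 fun a : S => ae_all_iff.2 fun b : S => h a b] with w hw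
    refine isNormalizedTightFrame_euclideanSpace_iff.2 fun a b => ?_
    simpa [fiberVec, Subtype.coe_inj] using hw a b

end FiberFrames

section FourierHat

theorem ae_comp_div_iff {p : ℝ → Prop} {c : ℝ} (hc : c ≠ 0) : (∀ᵐ x, p (x / c)) ↔ ∀ᵐ x, p x := by
  have map_div : Measure.map (fun x : ℝ => x * c⁻¹) volume = ENNReal.ofReal |c| • volume := by
    rw [map_volume_mul_right (inv_ne_zero hc), inv_inv]
  simp only [div_eq_mul_inv]
  rw [← (measurableEmbedding_mulRight₀ (inv_ne_zero hc)).ae_map_iff, map_div,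
    Measure.ae_ennreal_smul_measure_iff (by simpa using hc)]

variable {ι : Type*} [Countable ι] {n : ℕ} {θ : Fin n → ℝ} {φ : ι → L2Rn n}

theorem ae_hasSum_fourierHat_iff (i j : Fin n) (k : ℤ) (z : ℂ) :
    (∀ᵐ ξ, HasSum (fun l => fourierHat (φ l i) (ξ - θ i) *
        conj (fourierHat (φ l j) (ξ - θ j + 2 * k * π))) z) ↔
      ∀ m : ℤ, ∀ᵐ w ∂volume.restrict (Ioc 0 1),
        HasSum (fun l => fiber θ (i, m) (φ l) w * conj (fiber θ (j, m + k) (φ l) w)) z := by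
  have cell_left (ξ : ℝ) : (ξ - θ i) / (2 * π) = ξ / (2 * π) - θ i / (2 * π) := sub_div _ _ _
  have cell_right (ξ : ℝ) :
      (ξ - θ j + 2 * k * π) / (2 * π) = ξ / (2 * π) - θ j / (2 * π) + k := by
    field_simp
  simp only [fourierHat, cell_left, cell_right]
  rw [ae_comp_div_iff (p := fun x => HasSum (fun l => (𝓕 (φ l i) : L2R) (x - θ i / (2 * π)) *
    conj ((𝓕 (φ l j) : L2R) (x - θ j / (2 * π) + k))) z) two_pi_pos.ne', ae_iff_forall_ae_Ioc 0]
  refine forall_congr' fun m => eventually_congr ?_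
  filter_upwards [ae_all_iff.2 fun l => coeFn_fiber θ (i, m) (φ l),
    ae_all_iff.2 fun l => coeFn_fiber θ (j, m + k) (φ l)] with w fiber_left fiber_right
  have left_eq : w + (0 + m) - θ i / (2 * π) = w + cellStart θ (i, m) := by
    rw [cellStart]; ring
  have right_eq : w + (0 + m) - θ j / (2 * π) + k = w + cellStart θ (j, m + k) := by
    rw [cellStart]; push_cast; ring
  simp only [left_eq, right_eq, fiber_left, fiber_right]

end FourierHat

theorem isNTFGenerator_top_iff {n : ℕ} {θ : Fin n → ℝ} {Φ : Set (L2Rn n)} :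
    IsNTFGenerator θ ⊤ Φ ↔
      IsNormalizedTightFrame ⊤ fun p : ℤ × Φ => shift θ p.1 (p.2 : L2Rn n) :=
  ⟨IsNTFGenerator.frame, fun h => ⟨fun _ _ _ => trivial, fun _ _ => trivial, h⟩⟩

end SuperWavelet

end

theorem mainTheorem6_general {ι : Type*} [Countable ι] {n : ℕ} (θ : Fin n → ℝ)
    (φ : ι → SuperWavelet.L2Rn n) :
    SuperWavelet.IsNormalizedTightFrame ⊤ (fun p : ℤ × ι => SuperWavelet.shift θ p.1 (φ p.2)) ↔
      ∀ (i j : Fin n) (k : ℤ), ∀ᵐ ξ : ℝ, HasSum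
        (fun l => SuperWavelet.fourierHat (φ l i) (ξ - θ i) *
          conj (SuperWavelet.fourierHat (φ l j) (ξ - θ j + 2 * k * Real.pi)))
        (if i = j ∧ k = 0 then 1 else 0) := by
  simp only [SuperWavelet.isNormalizedTightFrame_shift_iff_hasSum_fiber,
    SuperWavelet.ae_hasSum_fourierHat_iff]
  refine ⟨fun h i j k m => ?_, fun h ⟨i, m⟩ ⟨j, m'⟩ => ?_⟩
  · simpa [Prod.ext_iff] using h (i, m) (j, m + k)
  · simpa [Prod.ext_iff, sub_eq_zero, eq_comm (a := m)] using h i j (m' - m) m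

theorem mainTheorem6 {n : ℕ} (θ : Fin n → ℝ) (Φ : Set (SuperWavelet.L2Rn n))
    (hΦ : Φ.Countable) :
    SuperWavelet.IsNTFGenerator θ ⊤ Φ ↔
      ∀ (i j : Fin n) (k : ℤ), ∀ᵐ ξ : ℝ ∂volume,
        HasSum
          (fun φ : Φ =>
            SuperWavelet.fourierHat ((φ : SuperWavelet.L2Rn n) i) (ξ - θ i) *
              conj (SuperWavelet.fourierHat ((φ : SuperWavelet.L2Rn n) j)
                (ξ - θ j + 2 * (k : ℝ) * Real.pi)))
          (if i = j ∧ k = 0 then (1 : ℂ) else 0) := by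
  have := hΦ.to_subtype
  exact SuperWavelet.isNTFGenerator_top_iff.trans (mainTheorem6_general θ _)
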